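/- Let $(\Omega,\mathcal F,\mathbb P)$ be a probability space with a filtration $\mathbb F=(\mathcal F_t)_{t\ge 0}$ satisfying the usual conditions (right-continuous, with $\mathcal F_0$ containing all $\mathbb P$-negligible sets), and let $\boldsymbol\tau=(\tau_1,\dots,\tau_n)$ be random times, i.e. $\mathcal F$-measurable $[0,\infty]$-valued variables. Assume the density hypothesis: there are a non-atomic $\sigma$-finite measure $\mu$ on $\mathbb R_+$ and, for every $t\ge 0$, a non-negative $\mathcal F_t\otimes\mathcal B(\mathbb R_+^n)$-measurable function $a_t$ such that, for every non-negative Borel function $h$, $$\mathbb E[h(\boldsymbol\tau)\mid\mathcal F_t]=\int_{\mathbb R_+^n}h(\mathbf u)\,a_t(\mathbf u)\,\mu^{\otimes n}(d\mathbf u)\quad\text{almost surely}$$ (in particular, $\boldsymbol\tau$ is almost surely finite). Notation. For $a,b\in[0,\infty]$ put $a\nmid b=a$ if $a\le b$ and $a\nmid b=\infty$ if $a>b$. Let $\varrho:\{1,\dots,k\}\to\{1,\dots,n\}$ be injective, $\boldsymbol\tau_\varrho=(\tau_{\varrho(1)},\dots,\tau_{\varrho(k)})$, and for a random variable $V\ge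 0$ put $\sigma(\boldsymbol\tau_\varrho\nmid V)=\bigvee_{i=1}^k\sigma(\tau_{\varrho(i)}\nmid V)$. The progressive enlargement $\mathbb F^{\boldsymbol\tau_\varrho}$ of $\mathbb F$ is given by $$\mathcal F^{\boldsymbol\tau_\varrho}_t=\bigcap_{s>t}\bigl(\mathcal F_s\vee\sigma(\boldsymbol\tau_\varrho\nmid s)\bigr),\qquad t\ge 0.$$ For $T\subset\{1,\dots,k\}$ let $\sigma(\boldsymbol\tau_{\varrho(T)})=\bigvee_{i\in T}\sigma(\tau_{\varrho(i)})$ and, for $t\ge0$, $$A_{t,T,\varrho}=\Bigl\{\mathbf x\in[0,\infty]^n:\ \max_{i\in T}x_{\varrho(i)}\le t<\min_{i\notin T}x_{\varrho(i)}\Bigr\}$$ (with $\max\emptyset=0$, $\min\emptyset=\infty$). For $\sigma$-algebras $\mathcal K,\mathcal H$ and a set $D\subset\Omega$, write $\mathcal K\cap D=\mathcal H\cap D$ if for every $X\in\mathcal K$ there is $Y\in\mathcal H$ with $X\cap D=Y\cap D$, and conversely. Claim. For every bounded $\mathbb F$-stopping time $U$, $$\mathcal F^{\boldsymbol\tau_\varrho}_U=\mathcal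 F_U\vee\sigma(\boldsymbol\tau_\varrho\nmid U).$$ Moreover, for every subset $T$ of $\{1,\dots,k\}$, the process $t\mapsto\mathbf 1_{A_{t,T,\varrho}}(\boldsymbol\tau)$ is $\mathbb F^{\boldsymbol\tau_\varrho}$-optional (measurable with respect to the $\sigma$-algebra on $\mathbb R_+\times\Omega$ generated by the $\mathbb F^{\boldsymbol\tau_\varrho}$-adapted càdlàg processes), and $$\mathcal F^{\boldsymbol\tau_\varrho}_U\cap\{\boldsymbol\tau\in A_{U,T,\varrho}\}=\bigl(\mathcal F_U\vee\sigma(\boldsymbol\tau_\varrho\nmid U)\bigr)\cap\{\boldsymbol\tau\in A_{U,T,\varrho}\}=\bigl(\mathcal F_U\vee\sigma(\boldsymbol\tau_{\varrho(T)})\bigr)\cap\{\boldsymbol\tau\in A_{U,T,\varrho}\}.$$ -/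

import Mathlib

open MeasureTheory Filter Topology
open scoped ENNReal NNReal

namespace RandomTimes

/-- `a ∤ b`: it equals `a` if `a ≤ b`, and `∞` if `a > b`. -/
noncomputable def nmid (a b : ℝ≥0∞) : ℝ≥0∞ := if a ≤ b then a else ∞

theorem measurable_nmid {Ω : Type*} [MeasurableSpace Ω] {f g : Ω → ℝ≥0∞}
    (hf : Measurable f) (hg : Measurable g) : Measurable fun ω => nmid (f ω) (g ω) :=
  Measurable.ite (measurableSet_le hf hg) hf measurable_const

/-- The σ-algebra `σ(ξ) = ⋁ᵢ σ(ξᵢ)` generated by a family of `[0, ∞]`-valued variables. -/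
@[reducible]
def sigmaOf {Ω ι : Type*} (ξ : ι → Ω → ℝ≥0∞) : MeasurableSpace Ω :=
  ⨆ i, MeasurableSpace.comap (ξ i) inferInstance

/-- The family `ξ ∤ V = (ξᵢ ∤ V)ᵢ` for a random level `V`. -/
noncomputable def nmidFamily {Ω ι : Type*} (ξ : ι → Ω → ℝ≥0∞) (V : Ω → ℝ≥0∞) :
    ι → Ω → ℝ≥0∞ :=
  fun i ω => nmid (ξ i ω) (V ω)

theorem sigmaOf_nmidFamily_le {Ω ι : Type*} {m : MeasurableSpace Ω} {ξ : ι → Ω → ℝ≥0∞}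
    (hξ : ∀ i, Measurable (ξ i)) (s : ℝ≥0) : sigmaOf (nmidFamily ξ fun _ => (s : ℝ≥0∞)) ≤ m :=
  iSup_le fun i => (measurable_nmid (hξ i) measurable_const).comap_le

/-- The filtration satisfies the usual conditions: right-continuity, and all `P`-null sets (hence,
as `𝓕 0 ≤ m`, all `P`-negligible sets, so that `P` is complete) belong to `𝓕 0`. -/
structure UsualConditions {Ω : Type*} {m : MeasurableSpace Ω} (𝓕 : Filtration ℝ≥0 m)
    (P : Measure Ω) : Prop where
  rightContinuous : ∀ t : ℝ≥0, (⨅ s > t, 𝓕 s) = 𝓕 t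
  null_mem : ∀ N : Set Ω, P N = 0 → MeasurableSet[𝓕 0] N

/-- The progressive enlargement of `𝓕` with the random times `ξ`:
`𝓕^ξ_t = ⋂_{s > t} (𝓕_s ∨ σ(ξ ∤ s))`. -/
noncomputable def progressiveEnlargement {Ω ι : Type*} {m : MeasurableSpace Ω}
    (𝓕 : Filtration ℝ≥0 m) (ξ : ι → Ω → ℝ≥0∞) (hξ : ∀ i, Measurable (ξ i)) :
    Filtration ℝ≥0 m where
  seq t := ⨅ s > t, 𝓕 s ⊔ sigmaOf (nmidFamily ξ fun _ => (s : ℝ≥0∞))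
  mono' _ _ h := le_iInf₂ fun s hs => iInf₂_le s (h.trans_lt hs)
  le' t := iInf₂_le_of_le (t + 1) (lt_add_one t)
    (sup_le (𝓕.le _) (sigmaOf_nmidFamily_le hξ _))

theorem le_progressiveEnlargement {Ω ι : Type*} {m : MeasurableSpace Ω}
    (𝓕 : Filtration ℝ≥0 m) (ξ : ι → Ω → ℝ≥0∞) (hξ : ∀ i, Measurable (ξ i)) (t : ℝ≥0) :
    𝓕 t ≤ progressiveEnlargement 𝓕 ξ hξ t :=
  le_iInf₂ fun _ hs => (𝓕.mono (le_of_lt hs)).trans le_sup_left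

/-- A stopping time of `𝓕` is a stopping time of its progressive enlargement. -/
theorem isStoppingTime_progressiveEnlargement {Ω ι : Type*} {m : MeasurableSpace Ω}
    {𝓕 : Filtration ℝ≥0 m} {U : Ω → WithTop ℝ≥0} (hU : IsStoppingTime 𝓕 U)
    (ξ : ι → Ω → ℝ≥0∞) (hξ : ∀ i, Measurable (ξ i)) :
    IsStoppingTime (progressiveEnlargement 𝓕 ξ hξ) U :=
  fun t => le_progressiveEnlargement 𝓕 ξ hξ t _ (hU t)

/-- The trace inclusion `K ∩ D ⊆ H ∩ D`: every `K`-measurable set agrees on `D` with some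
`H`-measurable set. -/
def TraceLE {Ω : Type*} (K H : MeasurableSpace Ω) (D : Set Ω) : Prop :=
  ∀ X : Set Ω, MeasurableSet[K] X → ∃ Y : Set Ω, MeasurableSet[H] Y ∧ X ∩ D = Y ∩ D

/-- The σ-algebras `K` and `H` coincide on `D`, written `K ∩ D = H ∩ D`. -/
def CoincideOn {Ω : Type*} (K H : MeasurableSpace Ω) (D : Set Ω) : Prop :=
  TraceLE K H D ∧ TraceLE H K D

/-- Right-continuity with left limits, for a path on `[0, ∞)`. -/
def IsCadlag (f : ℝ≥0 → ℝ) : Prop :=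
  ∀ t, ContinuousWithinAt f (Set.Ici t) t ∧ ∃ l, Tendsto f (𝓝[<] t) (𝓝 l)

/-- The optional σ-algebra on `[0, ∞) × Ω`: it is generated by the adapted càdlàg processes. -/
@[reducible]
def optionalSigma {Ω : Type*} {m : MeasurableSpace Ω} (𝓖 : Filtration ℝ≥0 m) :
    MeasurableSpace (ℝ≥0 × Ω) :=
  ⨆ (X : ℝ≥0 → Ω → ℝ) (_ : Adapted 𝓖 X ∧ ∀ ω, IsCadlag fun t => X t ω),
    MeasurableSpace.comap (fun p : ℝ≥0 × Ω => X p.1 p.2) inferInstance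

/-- A real process is `𝓖`-optional. -/
def IsOptional {Ω : Type*} {m : MeasurableSpace Ω} (𝓖 : Filtration ℝ≥0 m)
    (X : ℝ≥0 → Ω → ℝ) : Prop :=
  Measurable[optionalSigma 𝓖] fun p : ℝ≥0 × Ω => X p.1 p.2

/-- The density hypothesis for `τ = (τ₁, …, τₙ)` with respect to `μ^{⊗n}`: for every `t` there is a
nonnegative `𝓕_t ⊗ 𝓑(ℝ₊ⁿ)`-measurable `a_t` such that, for every nonnegative Borel `h`,
`E[h(τ) | 𝓕_t] = ∫ h(u) a_t(u) μ^{⊗n}(du)` almost surely. Times take values in `[0, ∞]`, and `h` is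
defined on `[0, ∞]ⁿ`; since `μ` lives on `[0, ∞)`, the hypothesis makes `τ` finite almost surely. -/
def DensityHypothesis {Ω : Type*} {m : MeasurableSpace Ω} {n : ℕ} (𝓕 : Filtration ℝ≥0 m)
    (P : Measure Ω) (μ : Measure ℝ≥0) (τ : Fin n → Ω → ℝ≥0∞) : Prop :=
  ∃ a : ℝ≥0 → Ω → (Fin n → ℝ≥0) → ℝ≥0,
    (∀ t, Measurable[(𝓕 t).prod MeasurableSpace.pi]
      fun p : Ω × (Fin n → ℝ≥0) => a t p.1 p.2) ∧
    ∀ (t : ℝ≥0) (h : (Fin n → ℝ≥0∞) → ℝ≥0∞), Measurable h →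
      condLExp (𝓕 t) P (fun ω => h fun i => τ i ω) =ᵐ[P]
        fun ω => ∫⁻ u, h (fun i => (u i : ℝ≥0∞)) * (a t ω u : ℝ≥0∞) ∂(Measure.pi fun _ => μ)

/-- `A_{t,T,ϱ}`: the set of `x` with `max_{i ∈ T} x_{ϱ(i)} ≤ t < min_{i ∉ T} x_{ϱ(i)}`
(an empty maximum is `0`, an empty minimum is `∞`). -/
def setA {n k : ℕ} (t : ℝ≥0) (T : Finset (Fin k)) (ϱ : Fin k ↪ Fin n) : Set (Fin n → ℝ≥0∞) :=
  {x | (T.sup fun i => x (ϱ i)) ≤ (t : ℝ≥0∞) ∧ (t : ℝ≥0∞) < Tᶜ.inf fun i => x (ϱ i)}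

end RandomTimes

/-! Fix an event `X` of the enlarged past at `U`. For each `s`, `X ∩ {U < s}` has the form `(ω, ξ ∤
s) ∈ W s`, where `ξ` is the selected subfamily of `τ` and `W s` is measurable for `𝓕 s ⊗ 𝓑`. Let
grid times `U_N > U` tend to `U`. Since there are finitely many times, `ξ ∤ U_N = ξ ∤ U` for large
`N`, so the limsup `S` of the sets `W U_N` describes `X` at `ξ ∤ U`. By right-continuity every
section of `S` lies in the past at `U` (`exists_measurableSet_sections_of_enlargement`).

Measurable sections do not make `S` measurable for the product of that past with the Borel sets.
Conditional probabilities give a product-measurable `S'` agreeing with `S` almost surely for each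
fixed parameter (`exists_measurableSet_prod_of_sections`), but the null set depends on the
parameter. The density hypothesis removes this dependence: given `𝓕 r`, the law of `τ` has a
density, so by Tonelli a property true almost surely at each fixed `u` is true almost surely at `τ`
(`ae_mem_of_forall_ae_section`). As `ξ ∤ U` is always one of finitely many fixed functions of `τ`,
this covers it too, and the remaining null set lies in `𝓕 0`.

The reverse inclusion is stopping-time calculus, and the trace identities are checked coordinate by
coordinate. -/

namespace RandomTimes

/-! ### Sets with measurable sections and their product-measurable versions -/

section Sections

variable {Ω E : Type*} {𝒢 m : MeasurableSpace Ω} {mE : MeasurableSpace E}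

theorem tsum_indicator_one_of_pairwise_disjoint {α : Type*} {f : ℕ → Set α}
    (hd : Pairwise (Function.onFun Disjoint f)) (x : α) :
    (⋃ i, f i).indicator (1 : α → ℝ≥0∞) x = ∑' i, (f i).indicator 1 x := by
  by_cases hx : x ∈ ⋃ i, f i
  · obtain ⟨j, hj⟩ := Set.mem_iUnion.1 hx
    rw [tsum_eq_single j fun i hij => Set.indicator_of_notMem
      (fun hi => Set.disjoint_left.1 (hd hij) hi hj) _, Set.indicator_of_mem hx,
      Set.indicator_of_mem hj]
  · rw [Set.indicator_of_notMem hx, eq_comm, ENNReal.tsum_eq_zero]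
    exact fun i => Set.indicator_of_notMem (fun hi => hx (Set.mem_iUnion_of_mem i hi)) _

/-- A jointly measurable version of the conditional probabilities of the sections of a set. -/
theorem exists_measurable_condLExp_section (P : Measure Ω) [IsProbabilityMeasure P]
    (h𝒢 : 𝒢 ≤ m) (S : Set (Ω × E)) (hS : MeasurableSet S) :
    ∃ K : Ω × E → ℝ≥0∞, Measurable[𝒢.prod mE] K ∧
      ∀ u, condLExp 𝒢 P (((fun ω => (ω, u)) ⁻¹' S).indicator 1) =ᵐ[P] fun ω => K (ω, u) := by
  have hsec : ∀ (S : Set (Ω × E)), MeasurableSet S → ∀ u, MeasurableSet ((fun ω => (ω, u)) ⁻¹' S) :=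
    fun S hS u => measurable_prodMk_right hS
  induction S, hS using MeasurableSpace.induction_on_inter generateFrom_prod.symm
    isPiSystem_prod with
  | empty =>
    refine ⟨fun _ => 0, measurable_const, fun u => ?_⟩
    simp only [Set.preimage_empty, Set.indicator_empty]
    exact (condLExp_zero (mΩ := 𝒢) P).eventuallyEq
  | basic S hS =>
    obtain ⟨A, hA, B, hB, rfl⟩ := hS
    refine ⟨fun p => condLExp 𝒢 P (A.indicator 1) p.1 * B.indicator 1 p.2, ?_, fun u => ?_⟩
    · exact Measurable.mul
        ((measurable_condLExp 𝒢 P (A.indicator 1)).comp (@measurable_fst _ _ 𝒢 mE))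
        ((measurable_one.indicator hB).comp (@measurable_snd _ _ 𝒢 mE))
    · by_cases hu : u ∈ B
      · have : (fun ω => (ω, u)) ⁻¹' (A ×ˢ B) = A := by ext; simp [hu]
        rw [this]
        simp [hu]
      · have : (fun ω => (ω, u)) ⁻¹' (A ×ˢ B) = ∅ := by ext; simp [hu]
        rw [this, Set.indicator_empty]
        refine (condLExp_zero (mΩ := 𝒢) P).eventuallyEq.trans (ae_of_all _ fun ω => ?_)
        simp [hu]
  | compl S hS ih =>
    obtain ⟨K, hK, hKS⟩ := ih
    refine ⟨fun p => 1 - K p, (measurable_const.sub measurable_id).comp hK, fun u => ?_⟩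
    have hsum := condLExp_add_left (mΩ := 𝒢) (P := P)
      (X := ((fun ω => (ω, u)) ⁻¹' S).indicator 1) (((fun ω => (ω, u)) ⁻¹' Sᶜ).indicator 1)
      (measurable_one.indicator (hsec S hS u)).aemeasurable
    rw [Set.preimage_compl, Set.indicator_self_add_compl, condLExp_one h𝒢] at hsum
    rw [Set.preimage_compl]
    filter_upwards [hsum, hKS u] with ω h1 h2
    simp only [Pi.one_apply, Pi.add_apply] at h1
    rw [← h2, h1]
    refine (ENNReal.add_sub_cancel_left (ne_of_lt ?_)).symm
    refine lt_of_le_of_lt ?_ ENNReal.one_lt_top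
    rw [h1]
    exact le_self_add
  | iUnion f hd hf ih =>
    choose K hK hKf using ih
    refine ⟨fun p => ∑' i, K i p, @Measurable.tsum _ _ _ (𝒢.prod mE) _ _ _ _ _ _ _ _ _ _ _ _ hK, fun u => ?_⟩
    have hind : ((fun ω => (ω, u)) ⁻¹' ⋃ i, f i).indicator (1 : Ω → ℝ≥0∞)
        = ∑' i, ((fun ω => (ω, u)) ⁻¹' f i).indicator 1 := by
      ext ω
      rw [Set.preimage_iUnion, ENNReal.tsum_apply,
        tsum_indicator_one_of_pairwise_disjoint fun i j hij => (hd hij).preimage _]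
    rw [hind]
    filter_upwards [condLExp_tsum (P := P)
      (X := fun i => ((fun ω => (ω, u)) ⁻¹' f i).indicator 1) 𝒢 fun i =>
      (measurable_one.indicator (hsec _ (hf i) u)).aemeasurable, ae_all_iff.2 fun i => hKf i u]
      with ω h1 h2
    rw [h1, ENNReal.tsum_apply]
    exact tsum_congr h2

/-- A jointly measurable set whose sections are `𝒢`-measurable agrees, almost surely in every
section, with a set measurable for the product of `𝒢` and the parameter σ-algebra. -/
theorem exists_measurableSet_prod_of_sections (P : Measure Ω) [IsProbabilityMeasure P]
    (h𝒢 : 𝒢 ≤ m) {S : Set (Ω × E)} (hS : MeasurableSet S)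
    (hsec : ∀ u, MeasurableSet[𝒢] ((fun ω => (ω, u)) ⁻¹' S)) :
    ∃ S' : Set (Ω × E), MeasurableSet[𝒢.prod mE] S' ∧
      ∀ u, ∀ᵐ ω ∂P, (ω, u) ∈ S ↔ (ω, u) ∈ S' := by
  obtain ⟨K, hK, hKS⟩ := exists_measurable_condLExp_section P h𝒢 S hS
  -- Each section is `𝒢`-measurable, so `K (·, u)` is almost surely its indicator and the level set
  -- at 1 recovers it.
  refine ⟨K ⁻¹' {1}, hK (measurableSet_singleton 1), fun u => ?_⟩
  have h := hKS u
  have hind : Measurable[𝒢] (((fun ω => (ω, u)) ⁻¹' S).indicator (1 : Ω → ℝ≥0∞)) :=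
    Measurable.indicator measurable_const (hsec u)
  rw [condLExp_eq_self h𝒢 P hind] at h
  filter_upwards [h] with ω hω
  rw [Set.mem_preimage, ← hω, Set.mem_singleton_iff]
  by_cases hmem : (ω, u) ∈ S <;> simp [Set.indicator, hmem]

/-- Measurability for `F ⊔ σ(g)` as the existence of a measurable set in the product. -/
theorem measurableSet_sup_comap_iff {F : MeasurableSpace Ω} {g : Ω → E} {X : Set Ω} :
    MeasurableSet[F ⊔ mE.comap g] X ↔
      ∃ W : Set (Ω × E), MeasurableSet[F.prod mE] W ∧ (fun ω => (ω, g ω)) ⁻¹' W = X := by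
  have : F ⊔ mE.comap g = (F.prod mE).comap fun ω => (ω, g ω) := by
    rw [MeasurableSpace.prod, MeasurableSpace.comap_sup, MeasurableSpace.comap_comp,
      MeasurableSpace.comap_comp]
    simp only [Function.comp_def]
    congr 1
    exact MeasurableSpace.comap_id.symm
  rw [this]
  rfl

end Sections

theorem sigmaOf_eq_comap {Ω ι : Type*} (ξ : ι → Ω → ℝ≥0∞) :
    sigmaOf ξ = MeasurableSpace.pi.comap fun ω i => ξ i ω := by
  simp only [sigmaOf, MeasurableSpace.pi, MeasurableSpace.comap_iSup, MeasurableSpace.comap_comp]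
  rfl

/-! ### Substituting `τ` for a fixed parameter -/

section Density

variable {Ω : Type*} {m : MeasurableSpace Ω} {n : ℕ} {𝓕 : Filtration ℝ≥0 m} {P : Measure Ω}
  [IsProbabilityMeasure P] {τ : Fin n → Ω → ℝ≥0∞} {μ : Measure ℝ≥0} [SigmaFinite μ]

/-- On rectangles this is the defining property of conditional expectation; a π-λ argument then lets
the test set depend on `ω` through `𝓕 r`. -/
theorem measure_preimage_eq_lintegral_density (hτ : ∀ i, Measurable (τ i)) {r : ℝ≥0}
    {a : Ω → (Fin n → ℝ≥0) → ℝ≥0}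
    (ha : Measurable[(𝓕 r).prod MeasurableSpace.pi] fun p : Ω × (Fin n → ℝ≥0) => a p.1 p.2)
    (hE : ∀ h : (Fin n → ℝ≥0∞) → ℝ≥0∞, Measurable h →
      condLExp (𝓕 r) P (fun ω => h fun i => τ i ω) =ᵐ[P]
        fun ω => ∫⁻ u, h (fun i => (u i : ℝ≥0∞)) * (a ω u : ℝ≥0∞) ∂(Measure.pi fun _ => μ))
    (V : Set (Ω × (Fin n → ℝ≥0∞))) (hV : MeasurableSet[(𝓕 r).prod MeasurableSpace.pi] V) :
    P ((fun ω => (ω, fun i => τ i ω)) ⁻¹' V) =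
      ∫⁻ ω, ∫⁻ u, V.indicator 1 (ω, fun i => (u i : ℝ≥0∞)) * (a ω u : ℝ≥0∞)
        ∂(Measure.pi fun _ => μ) ∂P := by
  have hle : (𝓕 r).prod (MeasurableSpace.pi : MeasurableSpace (Fin n → ℝ≥0)) ≤
      m.prod MeasurableSpace.pi := sup_le_sup (MeasurableSpace.comap_mono (𝓕.le r)) le_rfl
  have hle' : (𝓕 r).prod (MeasurableSpace.pi : MeasurableSpace (Fin n → ℝ≥0∞)) ≤
      m.prod MeasurableSpace.pi := sup_le_sup (MeasurableSpace.comap_mono (𝓕.le r)) le_rfl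
  have hcoe : Measurable fun p : Ω × (Fin n → ℝ≥0) => (p.1, fun i => (p.2 i : ℝ≥0∞)) := by
    fun_prop
  have hpair : Measurable fun ω => (ω, fun i => τ i ω) := by fun_prop
  have ha' : Measurable fun p : Ω × (Fin n → ℝ≥0) => (a p.1 p.2 : ℝ≥0∞) :=
    (ha.mono hle le_rfl).coe_nnreal_ennreal
  have hjoint : ∀ V : Set (Ω × (Fin n → ℝ≥0∞)), MeasurableSet V →
      Measurable fun p : Ω × (Fin n → ℝ≥0) =>
        V.indicator (1 : Ω × (Fin n → ℝ≥0∞) → ℝ≥0∞) (p.1, fun i => (p.2 i : ℝ≥0∞)) * (a p.1 p.2 : ℝ≥0∞) :=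
    fun V hV => ((measurable_one.indicator hV).comp hcoe).mul ha'
  have hsect : ∀ V : Set (Ω × (Fin n → ℝ≥0∞)), MeasurableSet V → ∀ ω,
      Measurable fun u : Fin n → ℝ≥0 =>
        V.indicator (1 : Ω × (Fin n → ℝ≥0∞) → ℝ≥0∞) (ω, fun i => (u i : ℝ≥0∞)) * (a ω u : ℝ≥0∞) :=
    fun V hV ω => (hjoint V hV).comp measurable_prodMk_left
  have hint : ∀ V : Set (Ω × (Fin n → ℝ≥0∞)), MeasurableSet V → Measurable fun ω =>
      ∫⁻ u, V.indicator (1 : Ω × (Fin n → ℝ≥0∞) → ℝ≥0∞) (ω, fun i => (u i : ℝ≥0∞)) *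
        (a ω u : ℝ≥0∞) ∂(Measure.pi fun _ => μ) :=
    fun V hV => (hjoint V hV).lintegral_prod_right'
  have hrect : ∀ A, MeasurableSet[𝓕 r] A → ∀ B : Set (Fin n → ℝ≥0∞), MeasurableSet B →
      P ((fun ω => (ω, fun i => τ i ω)) ⁻¹' (A ×ˢ B)) =
      ∫⁻ ω, ∫⁻ u, (A ×ˢ B).indicator 1 (ω, fun i => (u i : ℝ≥0∞)) * (a ω u : ℝ≥0∞)
        ∂(Measure.pi fun _ => μ) ∂P := by
    intro A hA B hB
    have h1 := setLIntegral_condLExp (𝓕.le r) P (fun ω => B.indicator 1 fun i => τ i ω) hA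
    have h2 : ∫⁻ ω in A, (B.indicator 1 fun i => τ i ω : ℝ≥0∞) ∂P =
        P ((fun ω => (ω, fun i => τ i ω)) ⁻¹' (A ×ˢ B)) := by
      rw [← lintegral_indicator (𝓕.le r _ hA), ← lintegral_indicator_one
        (hpair ((𝓕.le r _ hA).prod hB))]
      refine lintegral_congr fun ω => ?_
      by_cases hA' : ω ∈ A <;> by_cases hB' : (fun i => τ i ω) ∈ B <;>
        simp [Set.indicator, hA', hB']
    rw [← h2, ← h1, setLIntegral_congr_fun_ae (𝓕.le r _ hA)
      ((hE _ (measurable_one.indicator hB)).mono fun ω h _ => h),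
      ← lintegral_indicator (𝓕.le r _ hA)]
    refine lintegral_congr fun ω => ?_
    by_cases hA' : ω ∈ A
    · simp only [Set.indicator_of_mem hA']
      refine lintegral_congr fun u => ?_
      by_cases hB' : (fun i => (u i : ℝ≥0∞)) ∈ B <;> simp [Set.indicator, hA', hB']
    · simp [Set.indicator, hA']
  induction V, hV using MeasurableSpace.induction_on_inter
    (@generateFrom_prod _ _ (𝓕 r) MeasurableSpace.pi).symm
    (@isPiSystem_prod _ _ (𝓕 r) MeasurableSpace.pi) with
  | empty => simp
  | basic V hV =>
    obtain ⟨A, hA, B, hB, rfl⟩ := hV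
    exact hrect A hA B hB
  | compl V hV ih =>
    have hV' := hle' _ hV
    -- The right-hand side has total mass 1, as the whole space is a rectangle; complements follow
    -- by subtraction.
    have huniv := hrect Set.univ .univ Set.univ .univ
    rw [Set.univ_prod_univ, Set.preimage_univ, measure_univ] at huniv
    have hsplit : (1 : ℝ≥0∞) =
        (∫⁻ ω, ∫⁻ u, V.indicator 1 (ω, fun i => (u i : ℝ≥0∞)) * (a ω u : ℝ≥0∞)
          ∂(Measure.pi fun _ => μ) ∂P) +
        ∫⁻ ω, ∫⁻ u, Vᶜ.indicator 1 (ω, fun i => (u i : ℝ≥0∞)) * (a ω u : ℝ≥0∞)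
          ∂(Measure.pi fun _ => μ) ∂P := by
      rw [← lintegral_add_left (hint V hV'), huniv]
      refine lintegral_congr fun ω => ?_
      rw [← lintegral_add_left (hsect V hV' ω)]
      refine lintegral_congr fun u => ?_
      by_cases h : (ω, fun i => (u i : ℝ≥0∞)) ∈ V <;> simp [Set.indicator, h]
    rw [Set.preimage_compl, prob_compl_eq_one_sub (hpair hV'), ih]
    refine ENNReal.sub_eq_of_eq_add_rev ?_ hsplit
    rw [← ih]
    exact measure_ne_top _ _
  | iUnion f hd hf ih =>
    rw [Set.preimage_iUnion, measure_iUnion (fun i j hij => (hd hij).preimage _)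
      fun i => hpair (hle' _ (hf i))]
    simp_rw [ih]
    rw [← lintegral_tsum fun i => (hint _ (hle' _ (hf i))).aemeasurable]
    refine lintegral_congr fun ω => ?_
    rw [← lintegral_tsum fun i =>
      (hsect _ (hle' _ (hf i)) ω).aemeasurable]
    refine lintegral_congr fun u => ?_
    rw [ENNReal.tsum_mul_right]
    congr 1
    exact (tsum_indicator_one_of_pairwise_disjoint hd _).symm

/-- Under the density hypothesis, a property of `(ω, u)` that is `𝓕 r ⊗ 𝓑`-measurable and holds
almost surely for every fixed `u` holds almost surely at `u = τ`. -/
theorem ae_mem_of_forall_ae_section (hτ : ∀ i, Measurable (τ i))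
    (hdens : DensityHypothesis 𝓕 P μ τ) {r : ℝ≥0} {V : Set (Ω × (Fin n → ℝ≥0∞))}
    (hV : MeasurableSet[(𝓕 r).prod MeasurableSpace.pi] V)
    (h : ∀ u, ∀ᵐ ω ∂P, (ω, u) ∈ V) : ∀ᵐ ω ∂P, (ω, fun i => τ i ω) ∈ V := by
  obtain ⟨a, ha, hE⟩ := hdens
  have hle : (𝓕 r).prod (MeasurableSpace.pi : MeasurableSpace (Fin n → ℝ≥0)) ≤
      m.prod MeasurableSpace.pi := sup_le_sup (MeasurableSpace.comap_mono (𝓕.le r)) le_rfl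
  have hle' : (𝓕 r).prod (MeasurableSpace.pi : MeasurableSpace (Fin n → ℝ≥0∞)) ≤
      m.prod MeasurableSpace.pi := sup_le_sup (MeasurableSpace.comap_mono (𝓕.le r)) le_rfl
  have hcoe : Measurable fun p : Ω × (Fin n → ℝ≥0) => (p.1, fun i => (p.2 i : ℝ≥0∞)) := by
    fun_prop
  have ha' : Measurable fun p : Ω × (Fin n → ℝ≥0) => (a r p.1 p.2 : ℝ≥0∞) :=
    ((ha r).mono hle le_rfl).coe_nnreal_ennreal
  have hjoint : Measurable fun p : Ω × (Fin n → ℝ≥0) =>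
      Vᶜ.indicator (1 : Ω × (Fin n → ℝ≥0∞) → ℝ≥0∞) (p.1, fun i => (p.2 i : ℝ≥0∞)) * (a r p.1 p.2 : ℝ≥0∞) :=
    ((measurable_one.indicator (hle' _ hV.compl)).comp hcoe).mul ha'
  change P ((fun ω => (ω, fun i => τ i ω)) ⁻¹' Vᶜ) = 0
  -- After the swap the inner integral is over `ω` at fixed `u`, where the section of `Vᶜ` is null.
  rw [measure_preimage_eq_lintegral_density hτ (ha r) (hE r) _ hV.compl,
    lintegral_lintegral_swap hjoint.aemeasurable]
  refine lintegral_eq_zero_of_ae_eq_zero (ae_of_all _ fun u => ?_)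
  refine lintegral_eq_zero_of_ae_eq_zero ((h fun i => (u i : ℝ≥0∞)).mono fun ω hω => ?_)
  simp [Set.indicator, hω]

end Density

/-! ### Traces of σ-algebras on a set -/

section Trace

variable {Ω : Type*} {K H : MeasurableSpace Ω} {D : Set Ω}

/-- The sets agreeing on `D` with an `H`-measurable set form a σ-algebra, so trace inclusions can be
checked on generators. -/
theorem traceLE_iff : TraceLE K H D ↔
    K ≤ (H.comap ((↑) : D → Ω)).map ((↑) : D → Ω) := by
  refine forall₂_congr fun X _ => exists_congr fun Y => and_congr_right fun _ => ?_
  rw [eq_comm, Subtype.preimage_val_eq_preimage_val_iff, Set.inter_comm D, Set.inter_comm D]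

theorem TraceLE.of_le (h : K ≤ H) : TraceLE K H D := fun X hX => ⟨X, h X hX, rfl⟩

theorem TraceLE.sup {K' : MeasurableSpace Ω} (h : TraceLE K H D) (h' : TraceLE K' H D) :
    TraceLE (K ⊔ K') H D :=
  traceLE_iff.2 (sup_le (traceLE_iff.1 h) (traceLE_iff.1 h'))

theorem TraceLE.iSup {ι : Sort*} {K : ι → MeasurableSpace Ω} (h : ∀ i, TraceLE (K i) H D) :
    TraceLE (⨆ i, K i) H D :=
  traceLE_iff.2 (iSup_le fun i => traceLE_iff.1 (h i))

theorem TraceLE.comap_of_eqOn {E : Type*} [mE : MeasurableSpace E] {f g : Ω → E}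
    (hg : Measurable[H] g) (h : Set.EqOn f g D) : TraceLE (mE.comap f) H D := by
  rintro _ ⟨B, hB, rfl⟩
  refine ⟨g ⁻¹' B, hg hB, ?_⟩
  ext ω
  simp only [Set.mem_inter_iff, Set.mem_preimage]
  exact and_congr_left fun hω => by rw [h hω]

theorem CoincideOn.of_eq (h : K = H) : CoincideOn K H D :=
  ⟨.of_le h.le, .of_le h.ge⟩

end Trace

/-! ### The times `ξ ∤ U` on the sets `A_{U,T,ϱ}` -/

section Level

variable {Ω ι : Type*}

theorem nmid_of_le {a b : ℝ≥0∞} (h : a ≤ b) : nmid a b = a := if_pos h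

theorem nmid_of_lt {a b : ℝ≥0∞} (h : b < a) : nmid a b = ∞ := if_neg h.not_ge

theorem measurable_sigmaOf (ξ : ι → Ω → ℝ≥0∞) (i : ι) : Measurable[sigmaOf ξ] (ξ i) :=
  Measurable.of_comap_le (le_iSup (fun i => MeasurableSpace.comap (ξ i) inferInstance) i)

theorem mem_setA_iff {n k : ℕ} {t : ℝ≥0} {T : Finset (Fin k)} {ϱ : Fin k ↪ Fin n}
    {x : Fin n → ℝ≥0∞} : x ∈ setA t T ϱ ↔ ∀ i, i ∈ T ↔ x (ϱ i) ≤ t := by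
  simp only [setA, Set.mem_ofPred_eq, Finset.sup_le_iff, Finset.lt_inf_iff ENNReal.coe_lt_top,
    Finset.mem_compl]
  refine ⟨fun h i => ⟨h.1 i, fun hi => ?_⟩, fun h => ⟨fun i => (h i).1, fun i hi => ?_⟩⟩
  · by_contra hiT
    exact (h.2 i hiT).not_ge hi
  · exact not_le.1 fun hle => hi ((h i).2 hle)

/-- On this event `τ (ϱ i) ∤ U` is `τ (ϱ i)` for `i ∈ T` and the constant `∞` otherwise. -/
theorem coincideOn_nmidFamily_setA {n k : ℕ} (F : MeasurableSpace Ω) (τ : Fin n → Ω → ℝ≥0∞)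
    (ϱ : Fin k ↪ Fin n) (U : Ω → ℝ≥0) (T : Finset (Fin k)) :
    CoincideOn (F ⊔ sigmaOf (nmidFamily (fun i => τ (ϱ i)) fun ω => (U ω : ℝ≥0∞)))
      (F ⊔ sigmaOf fun i : T => τ (ϱ i)) {ω | (fun i => τ i ω) ∈ setA (U ω) T ϱ} := by
  have hmem : ∀ ω ∈ {ω | (fun i => τ i ω) ∈ setA (U ω) T ϱ}, ∀ i, i ∈ T ↔ τ (ϱ i) ω ≤ U ω :=
    fun ω hω => mem_setA_iff (x := fun i => τ i ω).1 hω
  refine ⟨.sup (.of_le le_sup_left) (.iSup fun i => ?_),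
    .sup (.of_le le_sup_left) (.iSup fun i => ?_)⟩
  · by_cases hi : i ∈ T
    · exact TraceLE.comap_of_eqOn
        ((measurable_sigmaOf (fun i : T => τ (ϱ i)) ⟨i, hi⟩).mono le_sup_right le_rfl)
        fun ω hω => nmid_of_le ((hmem ω hω i).1 hi)
    · exact TraceLE.comap_of_eqOn (g := fun _ => ∞) measurable_const
        fun ω hω => nmid_of_lt (not_le.1 fun h => hi ((hmem ω hω i).2 h))
  · exact TraceLE.comap_of_eqOn
      ((measurable_sigmaOf (nmidFamily (fun i => τ (ϱ i)) fun ω => (U ω : ℝ≥0∞)) i).mono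
        le_sup_right le_rfl)
      fun ω hω => (nmid_of_le ((hmem ω hω i).1 i.2)).symm

end Level

/-! ### Easy inclusion and optionality -/

section Enlargement

variable {Ω ι : Type*} {m : MeasurableSpace Ω} {𝓕 : Filtration ℝ≥0 m} {ξ : ι → Ω → ℝ≥0∞}

/-- For `s > t`, truncating at `s` only sends to `∞` values already above `t`, so `ξ ≤ t` and `ξ ∤ s
≤ t` are the same event. -/
theorem measurableSet_le_progressiveEnlargement (hξ : ∀ i, Measurable (ξ i)) (i : ι) (t : ℝ≥0) :
    MeasurableSet[progressiveEnlargement 𝓕 ξ hξ t] {ω | ξ i ω ≤ t} := by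
  have hle : progressiveEnlargement 𝓕 ξ hξ t =
    ⨅ s > t, 𝓕 s ⊔ sigmaOf (nmidFamily ξ fun _ => (s : ℝ≥0∞)) := rfl
  rw [hle]
  simp only [MeasurableSpace.measurableSet_iInf]
  intro s hs
  have hst : (t : ℝ≥0∞) < s := ENNReal.coe_lt_coe.2 hs
  have h : {ω | ξ i ω ≤ t} = nmidFamily ξ (fun _ => (s : ℝ≥0∞)) i ⁻¹' Set.Iic (t : ℝ≥0∞) := by
    ext ω
    simp only [Set.mem_ofPred_eq, Set.mem_preimage, Set.mem_Iic, nmidFamily]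
    rcases le_or_gt (ξ i ω) s with h | h
    · rw [nmid_of_le h]
    · rw [nmid_of_lt h]
      simpa using hst.trans h
  rw [h]
  exact (measurable_sigmaOf (nmidFamily ξ fun _ => (s : ℝ≥0∞)) i).mono
    (le_sup_right : _ ≤ 𝓕 s ⊔ _) le_rfl measurableSet_Iic

theorem isStoppingTime_component (hξ : ∀ i, Measurable (ξ i)) (i : ι) :
    IsStoppingTime (progressiveEnlargement 𝓕 ξ hξ) (fun ω => (ξ i ω : WithTop ℝ≥0)) :=
  fun t => measurableSet_le_progressiveEnlargement hξ i t

/-- The easy inclusion in the description of the enlargement at a stopping time. -/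
theorem sup_sigmaOf_nmidFamily_le {U : Ω → ℝ≥0} (hU : IsStoppingTime 𝓕 fun ω => (U ω : WithTop ℝ≥0))
    (hξ : ∀ i, Measurable (ξ i)) :
    hU.measurableSpace ⊔ sigmaOf (nmidFamily ξ fun ω => (U ω : ℝ≥0∞)) ≤
      (isStoppingTime_progressiveEnlargement hU ξ hξ).measurableSpace := by
  refine sup_le (fun X hX => ?_) (iSup_le fun i => ?_)
  · exact ⟨iSup_mono (le_progressiveEnlargement 𝓕 ξ hξ) X hX.1,
      fun t => le_progressiveEnlargement 𝓕 ξ hξ t _ (hX.2 t)⟩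
  · set hU' := isStoppingTime_progressiveEnlargement hU ξ hξ
    have hi := isStoppingTime_component (𝓕 := 𝓕) hξ i
    refine Measurable.comap_le (measurable_of_Iic fun c => ?_)
    induction c with
    | top => simp
    | coe c =>
      -- The event `{ξ ≤ c} ∩ {ξ ≤ U}` belongs to the past at `min ξ U`, hence to the past at `U`.
      have h := (hi.measurableSet_min_iff hU' _).1
        (hi.measurableSet_inter_le hU' _ (hi.measurableSet_le' c))
      have heq : nmidFamily ξ (fun ω => (U ω : ℝ≥0∞)) i ⁻¹' Set.Iic (c : ℝ≥0∞) =
          {ω | (ξ i ω : WithTop ℝ≥0) ≤ (c : WithTop ℝ≥0)} ∩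
            {ω | (ξ i ω : WithTop ℝ≥0) ≤ (U ω : WithTop ℝ≥0)} := by
        ext ω
        change nmid (ξ i ω) (U ω) ≤ c ↔ ξ i ω ≤ (c : ℝ≥0∞) ∧ ξ i ω ≤ (U ω : ℝ≥0∞)
        rcases le_or_gt (ξ i ω) (U ω) with h | h
        · simp [nmid_of_le h, h]
        · simp [nmid_of_lt h, h]
      rw [heq]
      exact h.2

theorem isOptional_indicator_setA {n k : ℕ} {τ : Fin n → Ω → ℝ≥0∞} (hτ : ∀ i, Measurable (τ i))
    (ϱ : Fin k ↪ Fin n) (T : Finset (Fin k)) :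
    IsOptional (progressiveEnlargement 𝓕 (fun i => τ (ϱ i)) fun i => hτ (ϱ i))
      fun t ω => (setA t T ϱ).indicator (fun _ => (1 : ℝ)) fun i => τ i ω := by
  classical
  set 𝓖 := progressiveEnlargement 𝓕 (fun i => τ (ϱ i)) fun i => hτ (ϱ i)
  refine Measurable.of_comap_le
    (le_iSup₂_of_le (fun t ω => (setA t T ϱ).indicator (fun _ => (1 : ℝ)) fun i => τ i ω)
      ⟨fun t => ?_, fun ω t => ?_⟩ le_rfl)
  · have hA : MeasurableSet[𝓖 t] {ω | (fun i => τ i ω) ∈ setA t T ϱ} := by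
      simp only [mem_setA_iff, Set.ofPred_forall]
      refine MeasurableSet.iInter fun i => ?_
      have hi := measurableSet_le_progressiveEnlargement (𝓕 := 𝓕) (fun i => hτ (ϱ i)) i t
      by_cases hiT : i ∈ T
      · simpa [hiT] using hi
      · simp only [hiT, false_iff]
        exact hi.compl
    exact Measurable.indicator (m := 𝓖 t) (measurable_const (a := (1 : ℝ))) hA
  -- Just after `t` each comparison is frozen at `τ ≤ t`, and just before `t` at `τ < t`; hence the
  -- path is càdlàg.
  · have hright : ∀ᶠ s in 𝓝[≥] t, ∀ i, τ (ϱ i) ω ≤ (s : ℝ≥0) ↔ τ (ϱ i) ω ≤ t := by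
      refine eventually_all.2 fun i => ?_
      rcases le_or_gt (τ (ϱ i) ω) t with h | h
      · filter_upwards [self_mem_nhdsWithin] with s hs
        exact iff_of_true (h.trans (ENNReal.coe_le_coe.2 hs)) h
      · have hc : Tendsto (fun s : ℝ≥0 => (s : ℝ≥0∞)) (𝓝[≥] t) (𝓝 t) :=
          (ENNReal.continuous_coe.tendsto t).mono_left nhdsWithin_le_nhds
        filter_upwards [hc.eventually_lt_const h] with s hs
        exact iff_of_false hs.not_ge h.not_ge
    have hleft : ∀ᶠ s in 𝓝[<] t, ∀ i, τ (ϱ i) ω ≤ (s : ℝ≥0) ↔ τ (ϱ i) ω < t := by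
      refine eventually_all.2 fun i => ?_
      rcases le_or_gt (t : ℝ≥0∞) (τ (ϱ i) ω) with h | h
      · filter_upwards [self_mem_nhdsWithin] with s hs
        exact iff_of_false ((ENNReal.coe_lt_coe.2 hs).trans_le h).not_ge h.not_gt
      · have hc : Tendsto (fun s : ℝ≥0 => (s : ℝ≥0∞)) (𝓝[<] t) (𝓝 t) :=
          (ENNReal.continuous_coe.tendsto t).mono_left nhdsWithin_le_nhds
        filter_upwards [hc.eventually_const_lt h] with s hs
        exact iff_of_true hs.le h
    simp only [Set.indicator, mem_setA_iff]
    constructor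
    · refine tendsto_const_nhds.congr' ?_
      filter_upwards [hright] with s hs
      simp only [hs]
    · refine ⟨if ∀ i, i ∈ T ↔ τ (ϱ i) ω < t then 1 else 0, tendsto_const_nhds.congr' ?_⟩
      filter_upwards [hleft] with s hs
      simp only [hs]

end Enlargement

/-! ### Approximation of `U` from above by grid times -/

/-- The time on the grid of mesh `1 / (N + 1)` that ends the `j`-th cell `[j / (N + 1), ·)`. -/
noncomputable def gridTime (N j : ℕ) : ℝ≥0 := ((j + 1 : ℕ) : ℝ≥0) / ((N + 1 : ℕ) : ℝ≥0)

/-- The index of the cell of mesh `1 / (N + 1)` that contains `x`. -/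
noncomputable def gridIndex (N : ℕ) (x : ℝ≥0) : ℕ := ⌊x * ((N + 1 : ℕ) : ℝ≥0)⌋₊

theorem gridIndex_eq_iff {N j : ℕ} {x : ℝ≥0} :
    gridIndex N x = j ↔ ((j : ℝ≥0) / ((N + 1 : ℕ) : ℝ≥0) ≤ x ∧ x < gridTime N j) := by
  have hN : (0 : ℝ≥0) < ((N + 1 : ℕ) : ℝ≥0) := by positivity
  rw [gridIndex, gridTime, Nat.floor_eq_iff zero_le, div_le_iff₀ hN, lt_div_iff₀ hN]
  push_cast
  rfl

theorem lt_gridTime (N : ℕ) (x : ℝ≥0) : x < gridTime N (gridIndex N x) :=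
  (gridIndex_eq_iff.1 rfl).2

theorem gridTime_le (N : ℕ) (x : ℝ≥0) :
    gridTime N (gridIndex N x) ≤ x + 1 / ((N + 1 : ℕ) : ℝ≥0) := by
  have h := (gridIndex_eq_iff.1 (rfl : gridIndex N x = _)).1
  rw [gridTime, Nat.cast_add, Nat.cast_one, add_div]
  gcongr

theorem tendsto_gridTime (x : ℝ≥0) :
    Tendsto (fun N => gridTime N (gridIndex N x)) atTop (𝓝 x) := by
  have h : Tendsto (fun N : ℕ => x + 1 / ((N + 1 : ℕ) : ℝ≥0)) atTop (𝓝 x) := by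
    have h0 : Tendsto (fun N : ℕ => 1 / ((N + 1 : ℕ) : ℝ≥0)) atTop (𝓝 0) := by
      simpa using tendsto_one_div_add_atTop_nhds_zero_nat (𝕜 := ℝ≥0)
    simpa using tendsto_const_nhds.add h0
  exact tendsto_of_tendsto_of_tendsto_of_le_of_le tendsto_const_nhds h
    (fun N => (lt_gridTime N x).le) fun N => gridTime_le N x

/-! ### Description of the enlarged past by sets with measurable sections -/

section

variable {Ω ι : Type*} {m : MeasurableSpace Ω} {𝓕 : Filtration ℝ≥0 m} {P : Measure Ω}
  {U : Ω → ℝ≥0} {ξ : ι → Ω → ℝ≥0∞}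

theorem measurableSet_gridIndex_eq (hU : IsStoppingTime 𝓕 fun ω => (U ω : WithTop ℝ≥0))
    (N j : ℕ) : MeasurableSet[𝓕 (gridTime N j)] {ω | gridIndex N (U ω) = j} := by
  have hlt : ∀ t, MeasurableSet[𝓕 t] {ω | U ω < t} := fun t => by
    simpa only [WithTop.coe_lt_coe] using hU.measurableSet_lt t
  have hle : (j : ℝ≥0) / ((N + 1 : ℕ) : ℝ≥0) ≤ gridTime N j := by
    rw [gridTime]
    gcongr
    simp
  have heq : {ω | gridIndex N (U ω) = j} =
      {ω | U ω < gridTime N j} \ {ω | U ω < (j : ℝ≥0) / ((N + 1 : ℕ) : ℝ≥0)} := by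
    ext ω
    simp only [Set.mem_ofPred_eq, gridIndex_eq_iff, Set.mem_sdiff, not_lt]
    exact and_comm
  rw [heq]
  exact (hlt _).diff (𝓕.mono hle _ (hlt _))

/-- The part before `s` of a set of the enlarged past at `U` is known from `𝓕 s` and `ξ ∤ s`. -/
theorem measurableSet_inter_lt_of_enlargement (hU : IsStoppingTime 𝓕 fun ω => (U ω : WithTop ℝ≥0))
    (hξ : ∀ i, Measurable (ξ i)) {X : Set Ω}
    (hX : MeasurableSet[(isStoppingTime_progressiveEnlargement hU ξ hξ).measurableSpace] X)
    (s : ℝ≥0) :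
    MeasurableSet[𝓕 s ⊔ sigmaOf (nmidFamily ξ fun _ => (s : ℝ≥0∞))] (X ∩ {ω | U ω < s}) := by
  obtain ⟨Q, hQc, hQd⟩ := TopologicalSpace.exists_countable_dense ℝ≥0
  have heq : X ∩ {ω | U ω < s} = ⋃ q ∈ Q ∩ Set.Iio s, X ∩ {ω | (U ω : WithTop ℝ≥0) ≤ q} := by
    ext ω
    simp only [Set.mem_inter_iff, Set.mem_ofPred_eq, Set.mem_iUnion, Set.mem_Iio, exists_prop,
      WithTop.coe_le_coe]
    constructor
    · rintro ⟨hω, hlt⟩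
      obtain ⟨q, hq, h1, h2⟩ := hQd.exists_between hlt
      exact ⟨q, ⟨hq, h2⟩, hω, h1.le⟩
    · rintro ⟨q, ⟨-, h2⟩, hω, h1⟩
      exact ⟨hω, h1.trans_lt h2⟩
  rw [heq]
  refine MeasurableSet.biUnion (hQc.mono Set.inter_subset_left) fun q hq => ?_
  -- Since `q < s`, the term at `s` occurs in the intersection defining the enlargement at `q`.
  exact iInf₂_le (f := fun s (_ : s > q) => 𝓕 s ⊔ sigmaOf (nmidFamily ξ fun _ => (s : ℝ≥0∞)))
    s hq.2 _ (hX.2 q)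

/-- A time at most `U` is kept by both levels; a time beyond `U` is eventually beyond the grid times
too. -/
theorem eventually_nmidFamily_gridTime [Finite ι] (ξ : ι → Ω → ℝ≥0∞) (U : Ω → ℝ≥0) (ω : Ω) :
    ∀ᶠ N in atTop, ∀ i, nmid (ξ i ω) (gridTime N (gridIndex N (U ω))) = nmid (ξ i ω) (U ω) := by
  refine eventually_all.2 fun i => ?_
  rcases le_or_gt (ξ i ω) (U ω) with h | h
  · refine Eventually.of_forall fun N => ?_
    rw [nmid_of_le h, nmid_of_le (h.trans (ENNReal.coe_le_coe.2 (lt_gridTime N _).le))]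
  · filter_upwards [((ENNReal.continuous_coe.tendsto _).comp
      (tendsto_gridTime (U ω))).eventually_lt_const h] with N hN
    exact (nmid_of_lt hN).trans (nmid_of_lt h).symm

/-- Every event of the enlarged past at `U` is described by a jointly measurable set evaluated at
`ξ ∤ U`, all of whose sections belong to the past of `𝓕` at `U`. -/
theorem exists_measurableSet_sections_of_enlargement [Finite ι] (h𝓕 : UsualConditions 𝓕 P)
    (hU : IsStoppingTime 𝓕 fun ω => (U ω : WithTop ℝ≥0)) {c : ℝ≥0} (hc : ∀ ω, U ω ≤ c)
    (hξ : ∀ i, Measurable (ξ i)) {X : Set Ω}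
    (hX : MeasurableSet[(isStoppingTime_progressiveEnlargement hU ξ hξ).measurableSpace] X) :
    ∃ S : Set (Ω × (ι → ℝ≥0∞)), MeasurableSet[(𝓕 (c + 1)).prod MeasurableSpace.pi] S ∧
      (∀ u, MeasurableSet[hU.measurableSpace] ((fun ω => (ω, u)) ⁻¹' S)) ∧
      ∀ ω, (ω, fun i => nmid (ξ i ω) (U ω)) ∈ S ↔ ω ∈ X := by
  have hW : ∀ s : ℝ≥0, ∃ W : Set (Ω × (ι → ℝ≥0∞)), MeasurableSet[(𝓕 s).prod MeasurableSpace.pi] W ∧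
      (fun ω => (ω, fun i => nmid (ξ i ω) s)) ⁻¹' W = X ∩ {ω | U ω < s} := fun s =>
    measurableSet_sup_comap_iff.1 (by
      have h := measurableSet_inter_lt_of_enlargement hU hξ hX s
      rwa [sigmaOf_eq_comap] at h)
  choose W hWm hWX using hW
  let R : ℕ → Set (Ω × (ι → ℝ≥0∞)) := fun N => {p | p ∈ W (gridTime N (gridIndex N (U p.1)))}
  have hsecW : ∀ s u, MeasurableSet[𝓕 s] ((fun ω => (ω, u)) ⁻¹' W s) := fun s u =>
    (@measurable_prodMk_right _ _ (𝓕 s) MeasurableSpace.pi u) (hWm s)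
  have hRm : ∀ N, MeasurableSet[(𝓕 (c + 1)).prod MeasurableSpace.pi] (R N) := by
    intro N
    have heq : R N = ⋃ j, (Prod.fst ⁻¹' {ω | gridIndex N (U ω) = j}) ∩ W (gridTime N j) := by
      ext p
      simp [R]
    rw [heq]
    refine MeasurableSet.iUnion fun j => ?_
    -- A grid time exceeds `U ≤ c` by at most one mesh, itself at most 1; cells ending after `c + 1`
    -- are never visited.
    by_cases hj : gridTime N j ≤ c + 1
    · have hle : (𝓕 (gridTime N j)).prod (MeasurableSpace.pi : MeasurableSpace (ι → ℝ≥0∞)) ≤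
          (𝓕 (c + 1)).prod MeasurableSpace.pi :=
        sup_le_sup (MeasurableSpace.comap_mono (𝓕.mono hj)) le_rfl
      exact hle _ (((@measurable_fst _ _ (𝓕 (gridTime N j)) MeasurableSpace.pi)
        (measurableSet_gridIndex_eq hU N j)).inter (hWm _))
    · have hempty : {ω | gridIndex N (U ω) = j} = ∅ := by
        refine Set.eq_empty_of_forall_notMem fun ω hω => hj ?_
        have h1 := gridTime_le N (U ω)
        rw [Set.mem_ofPred_eq] at hω
        rw [hω] at h1
        refine h1.trans (add_le_add (hc ω) (div_le_one_of_le₀ ?_ zero_le))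
        exact_mod_cast Nat.le_add_left 1 N
      rw [hempty, Set.preimage_empty, Set.empty_inter]
      exact @MeasurableSet.empty _ (_)
  have hRsec : ∀ N u s, MeasurableSet[𝓕 s] ((fun ω => (ω, u)) ⁻¹' R N ∩
      {ω | gridTime N (gridIndex N (U ω)) ≤ s}) := by
    intro N u s
    have heq : (fun ω => (ω, u)) ⁻¹' R N ∩ {ω | gridTime N (gridIndex N (U ω)) ≤ s} =
        ⋃ j ∈ {j | gridTime N j ≤ s},
          {ω | gridIndex N (U ω) = j} ∩ (fun ω => (ω, u)) ⁻¹' W (gridTime N j) := by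
      ext ω
      simp only [R, Set.mem_inter_iff, Set.mem_preimage, Set.mem_ofPred_eq, Set.mem_iUnion,
        exists_prop]
      constructor
      · rintro ⟨h1, h2⟩
        exact ⟨_, h2, rfl, h1⟩
      · rintro ⟨j, h2, rfl, h1⟩
        exact ⟨h1, h2⟩
    rw [heq]
    exact MeasurableSet.biUnion (Set.to_countable _) fun j hj =>
      𝓕.mono hj _ ((measurableSet_gridIndex_eq hU N j).inter (hsecW _ u))
  refine ⟨limsup R atTop, @MeasurableSet.measurableSet_limsup _ (_) _ hRm, fun u => ?_,
    fun ω => ?_⟩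
  · set Z := (fun ω => (ω, u)) ⁻¹' limsup R atTop
    have hZ : ∀ t : ℝ≥0, MeasurableSet[𝓕 t] (Z ∩ {ω | (U ω : WithTop ℝ≥0) ≤ t}) := by
      intro t
      -- It suffices to work at each `s > t`: on `{U ≤ t}` the grid times are eventually at most
      -- `s`, so intersecting with that condition leaves the limsup unchanged.
      rw [← h𝓕.rightContinuous t]
      simp only [MeasurableSpace.measurableSet_iInf]
      intro s hs
      have heq : Z ∩ {ω | (U ω : WithTop ℝ≥0) ≤ t} =
          limsup (fun N => (fun ω => (ω, u)) ⁻¹' R N ∩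
            {ω | gridTime N (gridIndex N (U ω)) ≤ s}) atTop ∩ {ω | (U ω : WithTop ℝ≥0) ≤ t} := by
        ext ω
        refine and_congr_left fun hω => ?_
        have hts : ∀ᶠ N in atTop, gridTime N (gridIndex N (U ω)) ≤ s :=
          ((tendsto_gridTime (U ω)).eventually_lt_const
            ((WithTop.coe_le_coe.1 hω).trans_lt hs)).mono fun _ h => h.le
        change (ω, u) ∈ limsup R atTop ↔ _
        rw [mem_limsup_iff_frequently_mem, mem_limsup_iff_frequently_mem]
        exact frequently_congr (hts.mono fun N hN => ⟨fun h => ⟨h, hN⟩, fun h => h.1⟩)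
      rw [heq]
      exact (@MeasurableSet.measurableSet_limsup _ (𝓕 s) _ fun N => hRsec N u s).inter
        (𝓕.mono (le_of_lt hs) _ (hU t))
    refine ⟨?_, hZ⟩
    have heq : Z = Z ∩ {ω | (U ω : WithTop ℝ≥0) ≤ c} :=
      (Set.inter_eq_left.2 fun ω _ => WithTop.coe_le_coe.2 (hc ω)).symm
    rw [heq]
    exact le_iSup 𝓕 c _ (hZ c)
  · rw [mem_limsup_iff_frequently_mem]
    have h : ∀ᶠ N in atTop, ((ω, fun i => nmid (ξ i ω) (U ω)) ∈ R N ↔ ω ∈ X) := by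
      filter_upwards [eventually_nmidFamily_gridTime ξ U ω] with N hN
      have h1 := Set.ext_iff.1 (hWX (gridTime N (gridIndex N (U ω)))) ω
      simp only [Set.mem_preimage, hN] at h1
      -- The grid time is strictly above `U`, so the restriction to `{U < s}` in `W s` costs
      -- nothing.
      exact h1.trans (and_iff_left (lt_gridTime N (U ω)))
    rw [frequently_congr h]
    exact frequently_const

end

/-! ### The enlarged past at a bounded stopping time -/

section Main

variable {Ω : Type*} {m : MeasurableSpace Ω} {P : Measure Ω} [IsProbabilityMeasure P]
  {𝓕 : Filtration ℝ≥0 m} {n k : ℕ} {τ : Fin n → Ω → ℝ≥0∞} {μ : Measure ℝ≥0} [SigmaFinite μ]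
  {U : Ω → ℝ≥0}

/-- The enlarged past at a bounded stopping time is generated by the past and the times `τ ∤ U`. -/
theorem enlargement_le_sup_sigmaOf_nmidFamily (h𝓕 : UsualConditions 𝓕 P)
    (hτ : ∀ i, Measurable (τ i)) (hdens : DensityHypothesis 𝓕 P μ τ) (ϱ : Fin k ↪ Fin n)
    (hU : IsStoppingTime 𝓕 fun ω => (U ω : WithTop ℝ≥0)) {c : ℝ≥0} (hc : ∀ ω, U ω ≤ c) :
    (isStoppingTime_progressiveEnlargement hU
        (fun i => τ (ϱ i)) (fun i => hτ (ϱ i))).measurableSpace ≤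
      hU.measurableSpace ⊔ sigmaOf (nmidFamily (fun i => τ (ϱ i)) fun ω => (U ω : ℝ≥0∞)) := by
  classical
  intro X hX
  obtain ⟨S, hS, hsec, hSX⟩ :=
    exists_measurableSet_sections_of_enlargement h𝓕 hU hc (fun i => hτ (ϱ i)) hX
  have hle : (𝓕 (c + 1)).prod (MeasurableSpace.pi : MeasurableSpace (Fin k → ℝ≥0∞)) ≤
      m.prod MeasurableSpace.pi := sup_le_sup (MeasurableSpace.comap_mono (𝓕.le _)) le_rfl
  have hUle : hU.measurableSpace ≤ 𝓕 (c + 1) :=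
    (hU.measurableSpace_le_of_le_const fun ω => WithTop.coe_le_coe.2 (hc ω)).trans
      (𝓕.mono le_self_add)
  have hle' : hU.measurableSpace.prod (MeasurableSpace.pi : MeasurableSpace (Fin k → ℝ≥0∞)) ≤
      (𝓕 (c + 1)).prod MeasurableSpace.pi := sup_le_sup (MeasurableSpace.comap_mono hUle) le_rfl
  obtain ⟨S', hS', hSS'⟩ := exists_measurableSet_prod_of_sections P (hUle.trans (𝓕.le _))
    (hle _ hS) hsec
  -- With `T` the set of indices whose time is at most `U`, `π T` sends `τ` to the truncated family;
  -- there are finitely many `T`.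
  let π : Finset (Fin k) → (Fin n → ℝ≥0∞) → Fin k → ℝ≥0∞ :=
    fun T x i => if i ∈ T then x (ϱ i) else ∞
  have hπ : ∀ T, Measurable (π T) := fun T => measurable_pi_lambda _ fun i => by
    by_cases hi : i ∈ T
    · simpa only [π, if_pos hi] using measurable_pi_apply (ϱ i)
    · simpa only [π, if_neg hi] using measurable_const
  have hae : ∀ᵐ ω ∂P, ∀ T, ((ω, π T fun i => τ i ω) ∈ S ↔ (ω, π T fun i => τ i ω) ∈ S') := by
    refine ae_all_iff.2 fun T => ?_
    have hmap : Measurable[(𝓕 (c + 1)).prod MeasurableSpace.pi, (𝓕 (c + 1)).prod MeasurableSpace.pi]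
        fun p : Ω × (Fin n → ℝ≥0∞) => (p.1, π T p.2) :=
      Measurable.prodMk (m := (𝓕 (c + 1)).prod MeasurableSpace.pi)
        (@measurable_fst _ _ (𝓕 (c + 1)) _)
        ((hπ T).comp (@measurable_snd _ _ (𝓕 (c + 1)) _))
    have hV : MeasurableSet[(𝓕 (c + 1)).prod MeasurableSpace.pi] {p : Ω × (Fin k → ℝ≥0∞) |
        p ∈ S ↔ p ∈ S'} := by
      have heq : {p : Ω × (Fin k → ℝ≥0∞) | p ∈ S ↔ p ∈ S'} = (S ∩ S') ∪ (Sᶜ ∩ S'ᶜ) := by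
        ext p
        simp only [Set.mem_ofPred_eq, Set.mem_union, Set.mem_inter_iff, Set.mem_compl_iff]
        tauto
      rw [heq]
      exact (hS.inter (hle' _ hS')).union (hS.compl.inter (hle' _ hS').compl)
    exact ae_mem_of_forall_ae_section hτ hdens (hmap hV) fun u => hSS' (π T u)
  have hπU : ∀ ω, ∃ T, (π T fun i => τ i ω) = fun i => nmid (τ (ϱ i) ω) (U ω) := by
    intro ω
    refine ⟨Finset.univ.filter fun i => τ (ϱ i) ω ≤ U ω, funext fun i => ?_⟩
    simp [π, nmid]
  set H := hU.measurableSpace ⊔ sigmaOf (nmidFamily (fun i => τ (ϱ i)) fun ω => (U ω : ℝ≥0∞))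
  set Y := (fun ω => (ω, fun i => nmid (τ (ϱ i) ω) (U ω))) ⁻¹' S'
  have hY : MeasurableSet[H] Y := by
    have h := (measurableSet_sup_comap_iff (X := Y)).2 ⟨S', hS', rfl⟩
    exact (sup_le_sup le_rfl (sigmaOf_eq_comap _).ge : _ ≤ H) _ h
  have hnull : ∀ N : Set Ω, P N = 0 → MeasurableSet[H] N := fun N hN =>
    (le_sup_left : _ ≤ H) _ (hU.le_measurableSpace_of_const_le
      (fun ω => WithTop.coe_le_coe.2 (zero_le (a := U ω))) _ (h𝓕.null_mem N hN))
  have hXY : ∀ᵐ ω ∂P, ω ∈ X ↔ ω ∈ Y := by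
    filter_upwards [hae] with ω hω
    obtain ⟨T, hT⟩ := hπU ω
    have h := hω T
    rw [hT] at h
    exact (hSX ω).symm.trans h
  -- Both corrections to `Y` are null, so completeness makes them measurable even though `X` is not
  -- yet known to be.
  have heq : X = (Y \ {ω | ¬(ω ∈ X ↔ ω ∈ Y)}) ∪ (X ∩ {ω | ¬(ω ∈ X ↔ ω ∈ Y)}) := by
    ext ω
    simp only [Set.mem_union, Set.mem_sdiff, Set.mem_inter_iff, Set.mem_ofPred_eq]
    tauto
  rw [heq]
  exact (hY.diff (hnull _ hXY)).union (hnull _ (measure_mono_null Set.inter_subset_right hXY))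

end Main

end RandomTimes

theorem mainTheorem10 {Ω : Type*} {m : MeasurableSpace Ω} (P : Measure Ω) [IsProbabilityMeasure P]
    (𝓕 : Filtration ℝ≥0 m) (h𝓕 : RandomTimes.UsualConditions 𝓕 P)
    {n k : ℕ} (τ : Fin n → Ω → ℝ≥0∞) (hτ : ∀ i, Measurable (τ i))
    (μ : Measure ℝ≥0) [SigmaFinite μ] [NullSingletonClass μ]
    (hdens : RandomTimes.DensityHypothesis 𝓕 P μ τ)
    (ϱ : Fin k ↪ Fin n)
    (U : Ω → ℝ≥0) (hU : IsStoppingTime 𝓕 fun ω => (U ω : WithTop ℝ≥0))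
    (hUb : ∃ c : ℝ≥0, ∀ ω, U ω ≤ c) :
    (RandomTimes.isStoppingTime_progressiveEnlargement hU
        (fun i => τ (ϱ i)) (fun i => hτ (ϱ i))).measurableSpace
      = hU.measurableSpace ⊔
        RandomTimes.sigmaOf (RandomTimes.nmidFamily (fun i => τ (ϱ i)) fun ω => (U ω : ℝ≥0∞))
    ∧ ∀ T : Finset (Fin k),
      RandomTimes.IsOptional
        (RandomTimes.progressiveEnlargement 𝓕 (fun i => τ (ϱ i)) (fun i => hτ (ϱ i)))
        (fun t ω => (RandomTimes.setA t T ϱ).indicator (fun _ => (1 : ℝ)) fun i => τ i ω)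
      ∧ RandomTimes.CoincideOn
        (RandomTimes.isStoppingTime_progressiveEnlargement hU
          (fun i => τ (ϱ i)) (fun i => hτ (ϱ i))).measurableSpace
        (hU.measurableSpace ⊔
          RandomTimes.sigmaOf (RandomTimes.nmidFamily (fun i => τ (ϱ i)) fun ω => (U ω : ℝ≥0∞)))
        {ω | (fun i => τ i ω) ∈ RandomTimes.setA (U ω) T ϱ}
      ∧ RandomTimes.CoincideOn
        (hU.measurableSpace ⊔
          RandomTimes.sigmaOf (RandomTimes.nmidFamily (fun i => τ (ϱ i)) fun ω => (U ω : ℝ≥0∞)))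
        (hU.measurableSpace ⊔ RandomTimes.sigmaOf (fun i : T => τ (ϱ i)))
        {ω | (fun i => τ i ω) ∈ RandomTimes.setA (U ω) T ϱ} := by
  obtain ⟨c, hc⟩ := hUb
  have h := (RandomTimes.enlargement_le_sup_sigmaOf_nmidFamily h𝓕 hτ hdens ϱ hU hc).antisymm
    (RandomTimes.sup_sigmaOf_nmidFamily_le hU fun i => hτ (ϱ i))
  exact ⟨h, fun T => ⟨RandomTimes.isOptional_indicator_setA hτ ϱ T, .of_eq h,
    RandomTimes.coincideOn_nmidFamily_setA _ τ ϱ U T⟩⟩
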